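/- Let $V$ be a finite set. A coherent configuration (scheme) $\mathcal C=(V,\mathcal R)$ is a partition $\mathcal R$ of $V\times V$ into nonempty relations (basis relations) such that the diagonal $\Delta_V$ is a union of members of $\mathcal R$, $R^t\in\mathcal R$ whenever $R\in\mathcal R$, and for all $R,S,T\in\mathcal R$ the number $|\{w\in V : (u,w)\in R,\ (w,v)\in S\}|$ is the same for all $(u,v)\in T$. A fiber is a nonempty $X\subseteq V$ with $\Delta_X=\{(x,x):x\in X\}\in\mathcal R$; $\mathrm{Fib}(\mathcal C)$ is the set of fibers. For fibers $X,Y$ put $\mathcal R_{X,Y}=\{R\in\mathcal R : R\subseteq X\times Y\}$; the homogeneous component of $\mathcal C$ at $X$ is the scheme $\mathcal C_X=(X,\mathcal R_{X,X})$. The scheme $\mathcal C$ is balanced if there is a positive integer $r$ with $|\mathcal R_{X,Y}|=r$ for all $X,Y\in\mathrm{Fib}(\mathcal C)$. The adjacency algebra $\mathcal A(\mathcal C)$ is the linear span in $\mathrm{Mat}_V(\mathbb C)$ of the $\{0,1\}$ adjacency matrices $A_R$, $R\in\mathcal R$; it is a semisimple subalgebra. Let $\mathcal P(\mathcal C)$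 be its set of central primitive idempotents, i.e. the nonzero central idempotents that are not sums of two nonzero orthogonal central idempotents. For $P\in\mathcal P(\mathcal C)$ let $n_P$ be the positive integer with $\mathcal A(\mathcal C)P\cong \mathrm{Mat}_{n_P}(\mathbb C)$, and similarly for the schemes $\mathcal C_X$. For a fiber $X$ and $P\in\mathcal P(\mathcal C)$ put $P_X=P\,I_X$ with $I_X=A_{\Delta_X}$, regarded as an $X\times X$ matrix (its entries outside $X\times X$ vanish). **Theorem.** Let $\mathcal C$ be a scheme. Then $\mathcal C$ is balanced if and only if for every $X\in\mathrm{Fib}(\mathcal C)$ the map $P\mapsto P_X$ is a bijection from $\mathcal P(\mathcal C)$ to $\mathcal P(\mathcal C_X)$ and $n_P=|\mathrm{Fib}(\mathcal C)|\,n_{P_X}$ for all $P\in\mathcal P(\mathcal C)$. -/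

import Mathlib

/-- A coherent configuration (for short, scheme) on a finite set `V`: a set `rel` of nonempty binary
relations on `V` (the basis relations) satisfying the four axioms below. -/
structure CoherentConfiguration (V : Type*) [Finite V] where
  /-- The set of basis relations. -/
  rel : Set (Set (V × V))
  /-- The basis relations are nonempty and form a partition of `V × V`. -/
  isPartition : Setoid.IsPartition rel
  /-- The diagonal is a union of basis relations. -/
  diagonal : ∃ D ⊆ rel, ⋃₀ D = Set.diagonal V
  /-- The transpose of a basis relation is a basis relation. -/
  transpose : ∀ R ∈ rel, {p : V × V | (p.2, p.1) ∈ R} ∈ rel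
  /-- The intersection numbers are well defined. -/
  coherent : ∀ R ∈ rel, ∀ S ∈ rel, ∀ T ∈ rel, ∀ p ∈ T, ∀ q ∈ T,
    {w : V | (p.1, w) ∈ R ∧ (w, p.2) ∈ S}.ncard = {w : V | (q.1, w) ∈ R ∧ (w, q.2) ∈ S}.ncard

/-! ### Central primitive idempotents and their degrees in a complex algebra -/

section Algebra

variable {M : Type*} [Ring M] [Algebra ℂ M]

/-- The central idempotents of the algebra `A` (a subalgebra of an ambient algebra `M`). -/
def centralIdempotents (A : Subalgebra ℂ M) : Set M :=
  {P | P ∈ A ∧ P * P = P ∧ ∀ a ∈ A, a * P = P * a}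

/-- The central primitive idempotents of `A`: the nonzero central idempotents that are not the sum
of two nonzero orthogonal central idempotents of `A`. -/
def centralPrimitiveIdempotents (A : Subalgebra ℂ M) : Set M :=
  {P | P ∈ centralIdempotents A ∧ P ≠ 0 ∧
    ∀ Q₁ ∈ centralIdempotents A, ∀ Q₂ ∈ centralIdempotents A,
      Q₁ * Q₂ = 0 → P = Q₁ + Q₂ → Q₁ = 0 ∨ Q₂ = 0}

/-- The two-sided ideal `A P = {a P | a ∈ A}` of `A` generated by a central element `P`. -/
def blockIdeal (A : Subalgebra ℂ M) (P : M) : Submodule ℂ M :=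
  (Subalgebra.toSubmodule A).map (LinearMap.mulRight ℂ P)

/-- `A P` is isomorphic, as a `ℂ`-algebra, to the full matrix algebra `Mat_n(ℂ)`: there is a
`ℂ`-linear bijection that is multiplicative. -/
def HasDegree (A : Subalgebra ℂ M) (P : M) (n : ℕ) : Prop :=
  ∃ φ : blockIdeal A P ≃ₗ[ℂ] Matrix (Fin n) (Fin n) ℂ,
    ∀ x y z : blockIdeal A P, (z : M) = (x : M) * (y : M) → φ z = φ x * φ y

/-- The degree `n_P` of `P`: the positive integer `n` with `A P ≅ Mat_n(ℂ)`. There is at most one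
such `n`, and when `A` is finite-dimensional semisimple and `P` is a central primitive idempotent
there is exactly one. -/
noncomputable def idempotentDegree (A : Subalgebra ℂ M) (P : M) : ℕ :=
  sInf {n : ℕ | 0 < n ∧ HasDegree A P n}

/-- The degree is determined by the isomorphism type of `A P`. -/
theorem idempotentDegree_eq {A : Subalgebra ℂ M} {P : M} {n : ℕ} (hn : 0 < n)
    (h : HasDegree A P n) : idempotentDegree A P = n := by
  have key : ∀ m, HasDegree A P m → m = n := by
    rintro m ⟨φ, -⟩
    obtain ⟨ψ, -⟩ := h
    have e := (φ.symm.trans ψ).finrank_eq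
    simp only [Module.finrank_matrix, Fintype.card_fin, Module.finrank_self, mul_one] at e
    exact Nat.mul_self_inj.mp e
  have hs : {m : ℕ | 0 < m ∧ HasDegree A P m} = {n} := by
    ext m
    constructor
    · rintro ⟨-, hm⟩
      exact key m hm
    · rintro rfl
      exact ⟨hn, h⟩
  rw [idempotentDegree, hs, csInf_singleton]

end Algebra

namespace CoherentConfiguration

section Fibers

variable {V : Type*} [Finite V] (C : CoherentConfiguration V)

/-- The relation `Δ_X = {(x, x) | x ∈ X}`. -/
def diag {V : Type*} (X : Finset V) : Set (V × V) := {p | p.1 ∈ X ∧ p.1 = p.2}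

/-- `Fib(C)`: the set of fibers of `C`, i.e. of nonempty `X ⊆ V` such that `Δ_X` is a basis
relation. -/
def fibers : Set (Finset V) := {X | X.Nonempty ∧ diag X ∈ C.rel}

/-- `R_{X,Y}`: the set of basis relations contained in `X × Y`. -/
def relBetween (X Y : Finset V) : Set (Set (V × V)) :=
  {R ∈ C.rel | R ⊆ (X : Set V) ×ˢ (Y : Set V)}

/-- `C` is `r`-balanced if `|R_{X,Y}| = r` for all fibers `X`, `Y`. -/
def IsBalancedWith (r : ℕ) : Prop :=
  ∀ X ∈ C.fibers, ∀ Y ∈ C.fibers, (C.relBetween X Y).ncard = r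

/-- `C` is balanced if it is `r`-balanced for some positive integer `r`. -/
def IsBalanced : Prop := ∃ r : ℕ, 0 < r ∧ C.IsBalancedWith r

variable {C}

theorem eq_of_mem {R S : Set (V × V)} (hR : R ∈ C.rel) (hS : S ∈ C.rel) {p : V × V}
    (hpR : p ∈ R) (hpS : p ∈ S) : R = S :=
  (C.isPartition.2 p).unique ⟨hR, hpR⟩ ⟨hS, hpS⟩

/-- A basis relation that meets `X × X`, for a fiber `X`, is contained in it. -/
theorem subset_of_fiber {X : Finset V} (hX : X ∈ C.fibers) {R : Set (V × V)} (hR : R ∈ C.rel)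
    {p : V × V} (hp : p ∈ R) (h₁ : p.1 ∈ X) (h₂ : p.2 ∈ X) {q : V × V} (hq : q ∈ R) :
    q.1 ∈ X ∧ q.2 ∈ X := by
  constructor
  · have h := C.coherent _ hX.2 R hR R hR p hp q hq
    have hpos : 0 < {w : V | (p.1, w) ∈ diag X ∧ (w, p.2) ∈ R}.ncard :=
      (Set.ncard_pos (Set.toFinite _)).2 ⟨p.1, ⟨h₁, rfl⟩, hp⟩
    rw [h] at hpos
    obtain ⟨w, hw, -⟩ := (Set.ncard_pos (Set.toFinite _)).1 hpos
    exact hw.1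
  · have h := C.coherent R hR _ hX.2 R hR p hp q hq
    have hpos : 0 < {w : V | (p.1, w) ∈ R ∧ (w, p.2) ∈ diag X}.ncard :=
      (Set.ncard_pos (Set.toFinite _)).2 ⟨p.2, hp, ⟨h₂, rfl⟩⟩
    rw [h] at hpos
    obtain ⟨w, -, hw⟩ := (Set.ncard_pos (Set.toFinite _)).1 hpos
    obtain ⟨ha, hb⟩ := hw
    simp only at ha hb
    exact hb ▸ ha

/-- A relation on `X`, seen as a relation on `V`. -/
def extend {V : Type*} (X : Finset V) (S : Set (X × X)) : Set (V × V) :=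
  {p | ∃ (h₁ : p.1 ∈ X) (h₂ : p.2 ∈ X), ((⟨p.1, h₁⟩, ⟨p.2, h₂⟩) : X × X) ∈ S}

theorem mk_mem_extend {V : Type*} {X : Finset V} {S : Set (X × X)} {x y : X} :
    ((x : V), (y : V)) ∈ extend X S ↔ (x, y) ∈ S := by
  simp [extend]

theorem extend_injective {V : Type*} (X : Finset V) : Function.Injective (extend X) := by
  intro S T h
  ext ⟨x, y⟩
  rw [← mk_mem_extend, h, mk_mem_extend]

variable (C) in
/-- The homogeneous component `C_X = (X, R_{X,X})` of `C` at a fiber `X`. -/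
def component (X : Finset V) (hX : X ∈ C.fibers) : CoherentConfiguration X where
  rel := {S | extend X S ∈ C.relBetween X X}
  isPartition := by
    refine ⟨?_, ?_⟩
    · rintro ⟨h, -⟩
      have : extend X (∅ : Set (X × X)) = ∅ := by ext p; simp [extend]
      exact C.isPartition.1 (this ▸ h)
    · rintro ⟨x, y⟩
      obtain ⟨R, ⟨hR, hxy⟩, -⟩ := C.isPartition.2 ((x : V), (y : V))
      have hsub : ∀ q ∈ R, q.1 ∈ X ∧ q.2 ∈ X :=
        fun q hq => subset_of_fiber hX hR hxy x.2 y.2 hq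
      have hext : extend X {p : X × X | ((p.1 : V), (p.2 : V)) ∈ R} = R := by
        ext q
        constructor
        · rintro ⟨_, _, h⟩
          exact h
        · intro hq
          exact ⟨(hsub q hq).1, (hsub q hq).2, hq⟩
      refine ⟨{p : X × X | ((p.1 : V), (p.2 : V)) ∈ R}, ⟨⟨?_, ?_⟩, hxy⟩, ?_⟩
      · rw [hext]; exact hR
      · rw [hext]; exact fun q hq => hsub q hq
      · rintro S ⟨hS, hxyS⟩
        apply extend_injective X
        rw [hext]
        exact eq_of_mem hS.1 hR (mk_mem_extend.2 hxyS) hxy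
  diagonal := by
    have h : extend X (Set.diagonal X) = diag X := by
      ext ⟨a, b⟩
      simp only [extend, diag, Set.mem_ofPred_eq, Set.mem_diagonal_iff, Subtype.mk.injEq]
      constructor
      · rintro ⟨h₁, -, h⟩
        exact ⟨h₁, h⟩
      · rintro ⟨h₁, rfl⟩
        exact ⟨h₁, h₁, rfl⟩
    refine ⟨{Set.diagonal X}, ?_, Set.sUnion_singleton _⟩
    rintro _ rfl
    refine ⟨by rw [h]; exact hX.2, ?_⟩
    rintro q ⟨h₁, h₂, -⟩
    exact ⟨h₁, h₂⟩
  transpose := by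
    rintro S ⟨hS, -⟩
    have h : extend X {p : X × X | (p.2, p.1) ∈ S} = {p : V × V | (p.2, p.1) ∈ extend X S} := by
      ext p
      constructor
      · rintro ⟨h₁, h₂, h⟩
        exact ⟨h₂, h₁, h⟩
      · rintro ⟨h₁, h₂, h⟩
        exact ⟨h₂, h₁, h⟩
    refine ⟨by rw [h]; exact C.transpose _ hS, ?_⟩
    rintro q ⟨h₁, h₂, -⟩
    exact ⟨h₁, h₂⟩
  coherent := by
    rintro R ⟨hR, -⟩ S ⟨hS, -⟩ T ⟨hT, -⟩ p hp q hq
    have key : ∀ a b : X, {w : X | (a, w) ∈ R ∧ (w, b) ∈ S}.ncard =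
        {w : V | ((a : V), w) ∈ extend X R ∧ (w, (b : V)) ∈ extend X S}.ncard := by
      intro a b
      rw [← Set.ncard_image_of_injective _ (Subtype.val_injective (p := fun v => v ∈ X))]
      congr 1
      ext w
      constructor
      · rintro ⟨w, ⟨h₁, h₂⟩, rfl⟩
        exact ⟨mk_mem_extend.2 h₁, mk_mem_extend.2 h₂⟩
      · rintro ⟨⟨ha, hw, h₁⟩, ⟨hw', hb, h₂⟩⟩
        exact ⟨⟨w, hw⟩, ⟨h₁, h₂⟩, rfl⟩
    rw [key, key]
    exact C.coherent _ hR _ hS _ hT ((p.1 : V), (p.2 : V)) (mk_mem_extend.2 hp)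
      ((q.1 : V), (q.2 : V)) (mk_mem_extend.2 hq)

end Fibers

section Adjacency

variable {V : Type*} [Fintype V] [DecidableEq V] (C : CoherentConfiguration V)

open Classical in
/-- The adjacency matrix `A_R` of a relation `R`. -/
noncomputable def adjMatrix {V : Type*} (R : Set (V × V)) : Matrix V V ℂ :=
  Matrix.of fun u v => if (u, v) ∈ R then 1 else 0

theorem adjMatrix_apply {V : Type*} (R : Set (V × V)) [DecidablePred (· ∈ R)] (u v : V) :
    adjMatrix R u v = if (u, v) ∈ R then 1 else 0 := by
  simp [adjMatrix]

/-- The adjacency matrices of a family of basis relations add up to that of its union. -/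
theorem sum_adjMatrix_apply {V : Type*} [Finite V] (C : CoherentConfiguration V) (c : Set (V × V) → ℂ) (D : Finset (Set (V × V)))
    [DecidableEq (Set (V × V))]
    (hD : ∀ R ∈ D, R ∈ C.rel) {T : Set (V × V)} (hT : T ∈ C.rel) {u v : V} (huv : (u, v) ∈ T) :
    (∑ R ∈ D, c R • adjMatrix R) u v = if T ∈ D then c T else 0 := by
  classical
  rw [Matrix.sum_apply]
  have h : ∀ R ∈ D, (c R • adjMatrix R) u v = if T = R then c R else 0 := by
    intro R hR
    by_cases hTR : T = R
    · subst hTR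
      simp [adjMatrix_apply, huv]
    · have : (u, v) ∉ R := fun h => hTR (eq_of_mem hT (hD R hR) huv h)
      simp [adjMatrix_apply, this, hTR]
  rw [Finset.sum_congr rfl h, Finset.sum_ite_eq]

/-- The adjacency algebra of `C`: the linear span of the adjacency matrices of the basis relations,
which is a subalgebra of `Mat_V(ℂ)`. -/
noncomputable def adjacencyAlgebra : Subalgebra ℂ (Matrix V V ℂ) :=
  (Submodule.span ℂ (adjMatrix '' C.rel)).toSubalgebra
    (by
      classical
      obtain ⟨D, hD, hDu⟩ := C.diagonal
      have h : (1 : Matrix V V ℂ) = ∑ R ∈ (Set.toFinite D).toFinset, (1 : ℂ) • adjMatrix R := by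
        ext u v
        obtain ⟨T, ⟨hT, huv⟩, -⟩ := C.isPartition.2 (u, v)
        rw [C.sum_adjMatrix_apply (fun _ => 1) _ (fun R hR => hD (by simpa using hR)) hT huv,
          Matrix.one_apply]
        refine if_congr ?_ rfl rfl
        have h : u = v ↔ (u, v) ∈ ⋃₀ D := by rw [hDu]; exact Iff.rfl
        rw [Set.Finite.mem_toFinset, h]
        constructor
        · rintro ⟨S, hS, huvS⟩
          exact eq_of_mem (hD hS) hT huvS huv ▸ hS
        · intro h
          exact ⟨T, h, huv⟩
      rw [h]
      refine Submodule.sum_mem _ fun R hR => Submodule.smul_mem _ _ (Submodule.subset_span ?_)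
      exact ⟨R, hD (by simpa using hR), rfl⟩)
    (by
      classical
      intro a b ha hb
      refine Submodule.span_induction₂ (p := fun x y _ _ =>
        x * y ∈ Submodule.span ℂ (adjMatrix '' C.rel)) ?_ (by simp) (by simp)
        (fun x y z _ _ _ h₁ h₂ => by rw [add_mul]; exact Submodule.add_mem _ h₁ h₂)
        (fun x y z _ _ _ h₁ h₂ => by rw [mul_add]; exact Submodule.add_mem _ h₁ h₂)
        (fun r x y _ _ h => by rw [smul_mul_assoc]; exact Submodule.smul_mem _ _ h)
        (fun r x y _ _ h => by rw [mul_smul_comm]; exact Submodule.smul_mem _ _ h) ha hb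
      rintro _ _ ⟨R, hR, rfl⟩ ⟨S, hS, rfl⟩
      have hmul : ∀ u v : V, (adjMatrix R * adjMatrix S) u v =
          (({w : V | (u, w) ∈ R ∧ (w, v) ∈ S}.ncard : ℕ) : ℂ) := by
        intro u v
        rw [Matrix.mul_apply, Set.ncard_eq_toFinset_card', Set.toFinset_ofPred,
          Finset.card_filter, Nat.cast_sum]
        refine Finset.sum_congr rfl fun w _ => ?_
        rw [adjMatrix_apply, adjMatrix_apply]
        by_cases h₁ : (u, w) ∈ R <;> by_cases h₂ : (w, v) ∈ S <;> simp [h₁, h₂]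
      have h : adjMatrix R * adjMatrix S = ∑ T ∈ (Set.toFinite C.rel).toFinset,
          (if hT : T.Nonempty then (adjMatrix R * adjMatrix S) hT.some.1 hT.some.2 else 0) •
            adjMatrix T := by
        ext u v
        obtain ⟨T, ⟨hT, huv⟩, -⟩ := C.isPartition.2 (u, v)
        rw [C.sum_adjMatrix_apply _ _ (fun R hR => by simpa using hR) hT huv,
          if_pos (by simpa using hT), dif_pos ⟨_, huv⟩, hmul, hmul]
        have hne : T.Nonempty := ⟨_, huv⟩
        rw [C.coherent R hR S hS T hT (u, v) huv hne.some hne.some_mem]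
      rw [h]
      refine Submodule.sum_mem _ fun T hT => Submodule.smul_mem _ _ (Submodule.subset_span ?_)
      exact ⟨T, by simpa using hT, rfl⟩)

/-- `P(C)`: the set of central primitive idempotents of the adjacency algebra of `C`. -/
noncomputable def idempotents : Set (Matrix V V ℂ) :=
  centralPrimitiveIdempotents C.adjacencyAlgebra

/-- The degree `n_P` of `P ∈ P(C)`. -/
noncomputable def degree (P : Matrix V V ℂ) : ℕ :=
  idempotentDegree C.adjacencyAlgebra P

/-- `P_X = P I_X`, where `I_X` is the adjacency matrix of `Δ_X`, viewed as an `X × X` matrix under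
the identification `I_X Mat_V(ℂ) I_X = Mat_X(ℂ)`. -/
noncomputable def idempotentAt (X : Finset V) (P : Matrix V V ℂ) : Matrix X X ℂ :=
  (P * adjMatrix (diag X)).submatrix Subtype.val Subtype.val

end Adjacency

end CoherentConfiguration

/-!
The adjacency algebra `A` is closed under the conjugate transpose, hence semisimple
(`isSemisimpleRing_of_conjTranspose_mem`), and so isomorphic to a sum of matrix algebras
`Mat_{d_i}(ℂ)`. Its central primitive idempotents are the identities `P_i` of the summands
(`mem_centralPrimitiveIdempotents_iff`), and `P_i` has degree `d_i`.

For a fiber `X` let `r_i(X)` be the rank of the `i`-th component of the idempotent `I_X`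
(`CoherentConfiguration.blockRank`). Three facts about these numbers carry the argument.

* The component `C_X` has adjacency algebra `I_X A I_X`, which is the sum of the algebras
  `Mat_{r_i(X)}(ℂ)`; hence its central primitive idempotents are the `P_i I_X` with `r_i(X) > 0`,
  and `P_i I_X` has degree `r_i(X)` (`CoherentConfiguration.exists_algEquiv_component`).
* The matrices `I_X` add up to the identity, so that taking traces gives `∑ r_i(X) = d_i`, the sum
  being over the fibers (`CoherentConfiguration.sum_blockRank`).
* The basis relations between `X` and `Y` form a basis of `I_X A I_Y`, so that their number is
  `∑ r_i(X) r_i(Y)`, the sum being over `i` (`CoherentConfiguration.ncard_relBetween`).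

If the scheme is balanced, the vectors `r(X)` all have the same inner products with each other and
with themselves, so they are equal. Then `d_i = |Fib(C)| r_i(X)`, in particular `r_i(X) > 0`, and the
condition on the idempotents follows. Conversely, that condition gives `r_i(X) > 0`, since `P_i I_X`
is primitive and so nonzero, and `d_i = |Fib(C)| r_i(X)`. Hence `r_i(X)` does not depend on `X`, nor
does the number of basis relations between two fibers depend on the fibers.
-/

/-! ### Idempotent matrices -/

/-- An idempotent matrix `E` of rank `r` factors as `E = B C` with `C B = 1`, where `B` has `r`
columns: `B` is the inclusion of the range of `E`, and `C` is the projection onto it. -/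
theorem Matrix.exists_factor_of_isIdempotentElem {n : Type*} [Fintype n] [DecidableEq n]
    {E : Matrix n n ℂ} (hE : E * E = E) :
    ∃ (B : Matrix n (Fin E.rank) ℂ) (C : Matrix (Fin E.rank) n ℂ), C * B = 1 ∧ B * C = E := by
  let p := Matrix.toLin' E
  have hp : ∀ x, p (p x) = p x := fun x => by
    rw [← LinearMap.comp_apply, ← Matrix.toLin'_mul, hE]
  let b : Module.Basis (Fin E.rank) ℂ (LinearMap.range p) := Module.finBasisOfFinrankEq ℂ _ rfl
  let s := Pi.basisFun ℂ n
  refine ⟨LinearMap.toMatrix b s (LinearMap.range p).subtype,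
    LinearMap.toMatrix s b p.rangeRestrict, ?_, ?_⟩
  · rw [← LinearMap.toMatrix_comp, ← LinearMap.toMatrix_id b]
    congr 1
    ext ⟨_, x, rfl⟩ : 2
    simp [hp]
  · rw [← LinearMap.toMatrix_comp]
    have : (LinearMap.range p).subtype ∘ₗ p.rangeRestrict = p := by ext; simp
    rw [this]
    exact LinearMap.toMatrix'_toLin' E

theorem Matrix.trace_eq_rank_of_isIdempotentElem {n : Type*} [Fintype n] [DecidableEq n]
    {E : Matrix n n ℂ} (hE : E * E = E) : E.trace = E.rank := by
  obtain ⟨B, C, h₁, h₂⟩ := Matrix.exists_factor_of_isIdempotentElem hE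
  conv_lhs => rw [← h₂, Matrix.trace_mul_comm, h₁]
  simp

theorem Matrix.eq_zero_or_eq_one_of_central_idempotent {n : Type*} [Fintype n] [DecidableEq n]
    {E : Matrix n n ℂ} (hE : E * E = E) (hc : ∀ a, a * E = E * a) : E = 0 ∨ E = 1 := by
  obtain ⟨c, rfl⟩ := Matrix.mem_range_scalar_of_commute_single
    (M := E) fun i j _ => hc _
  cases isEmpty_or_nonempty n
  · left; exact Subsingleton.elim _ _
  · rw [← map_mul, Matrix.scalar_inj] at hE
    rcases (IsIdempotentElem.iff_eq_zero_or_one (p := c)).1 hE with rfl | rfl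
    · left; simp
    · right; simp

/-- If `E` and `F` are families of idempotent matrices, the corner `E a F = a` of the product of
matrix algebras has dimension `∑ rank E_i * rank F_i`. -/
theorem Matrix.finrank_corner_pi {ι : Type*} [Fintype ι] {d : ι → ℕ}
    (E F : Π i, Matrix (Fin (d i)) (Fin (d i)) ℂ) (hE : E * E = E) (hF : F * F = F)
    (S : Submodule ℂ (Π i, Matrix (Fin (d i)) (Fin (d i)) ℂ)) (hS : ∀ a, a ∈ S ↔ E * a * F = a) :
    Module.finrank ℂ S = ∑ i, (E i).rank * (F i).rank := by
  choose B C hCB hBC using fun i =>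
    Matrix.exists_factor_of_isIdempotentElem (E := E i) (congrFun hE i)
  choose B' C' hCB' hBC' using fun i =>
    Matrix.exists_factor_of_isIdempotentElem (E := F i) (congrFun hF i)
  have key : ∀ i (x : Matrix (Fin (E i).rank) (Fin (F i).rank) ℂ),
      C i * (B i * x * C' i) * B' i = x := fun i x => by
    calc _ = (C i * B i) * x * (C' i * B' i) := by simp only [Matrix.mul_assoc]
      _ = x := by rw [hCB, hCB', Matrix.one_mul, Matrix.mul_one]
  have key' : ∀ i a, B i * (C i * a * B' i) * C' i = E i * a * F i := fun i a => by
    calc _ = (B i * C i) * a * (B' i * C' i) := by simp only [Matrix.mul_assoc]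
      _ = _ := by rw [hBC, hBC']
  let e : S ≃ₗ[ℂ] Π i, Matrix (Fin (E i).rank) (Fin (F i).rank) ℂ :=
    { toFun := fun a i => C i * a.1 i * B' i
      map_add' := fun a b => by ext1 i; simp [Matrix.mul_add, Matrix.add_mul]
      map_smul' := fun c a => by ext1 i; simp
      invFun := fun x => ⟨fun i => B i * x i * C' i, (hS _).2 <| by
        ext1 i
        simp only [Pi.mul_apply]
        rw [← key', key]⟩
      left_inv := fun a => Subtype.ext <| by
        ext1 i
        exact (key' i _).trans (congrFun ((hS a).1 a.2) i)
      right_inv := fun x => by ext1 i; exact key i _ }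
  rw [e.finrank_eq, Module.finrank_pi_fintype]
  simp [Module.finrank_matrix]

/-! ### Central primitive idempotents of a sum of matrix algebras -/

section Blocks

variable {M : Type*} [Ring M] [Algebra ℂ M] {A : Subalgebra ℂ M} {ι : Type*} [DecidableEq ι]
  {d : ι → ℕ}

/-- The element of `A` that corresponds to the identity matrix of the `i`-th summand under an
isomorphism of `A` with a product of matrix algebras. Summands of size `0` are allowed, and for them
this element is `0`. -/
noncomputable def blockIdempotent (ψ : A ≃ₐ[ℂ] Π i, Matrix (Fin (d i)) (Fin (d i)) ℂ) (i : ι) : M :=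
  (ψ.symm (Pi.single i 1) : A)

variable (ψ : A ≃ₐ[ℂ] Π i, Matrix (Fin (d i)) (Fin (d i)) ℂ)

theorem blockIdempotent_mem (i : ι) : blockIdempotent ψ i ∈ A := Subtype.property _

theorem apply_blockIdempotent (i : ι) (h : blockIdempotent ψ i ∈ A) :
    ψ ⟨blockIdempotent ψ i, h⟩ = Pi.single i 1 := by
  simp [blockIdempotent]

theorem blockIdempotent_ne_zero {i : ι} (hi : 0 < d i) : blockIdempotent ψ i ≠ 0 := by
  intro h
  have : Nonempty (Fin (d i)) := ⟨⟨0, hi⟩⟩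
  have h0 := congrFun ((apply_blockIdempotent ψ i (blockIdempotent_mem ψ i)).symm.trans
    ((congrArg ψ (Subtype.ext h : _ = (0 : A))).trans (map_zero ψ))) i
  simp at h0

theorem size_pos_of_blockIdempotent_ne_zero {i : ι} (hi : blockIdempotent ψ i ≠ 0) : 0 < d i := by
  by_contra h
  have h0 : d i = 0 := by omega
  have : IsEmpty (Fin (d i)) := by rw [h0]; infer_instance
  apply hi
  have : (Pi.single i 1 : Π i, Matrix (Fin (d i)) (Fin (d i)) ℂ) = 0 := by
    rw [Subsingleton.elim (1 : Matrix (Fin (d i)) (Fin (d i)) ℂ) 0, Pi.single_zero]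
  rw [blockIdempotent, this, map_zero, ZeroMemClass.coe_zero]

theorem blockIdempotent_injOn : Set.InjOn (blockIdempotent ψ) {i | 0 < d i} := by
  intro i hi j _ h
  have h1 : (Pi.single i 1 : Π i, Matrix (Fin (d i)) (Fin (d i)) ℂ) = Pi.single j 1 :=
    ψ.symm.injective (Subtype.ext h)
  by_contra hij
  have h2 := congrFun h1 i
  have : Nonempty (Fin (d i)) := ⟨⟨0, hi⟩⟩
  rw [Pi.single_eq_same, Pi.single_eq_of_ne hij] at h2
  exact one_ne_zero h2

theorem blockIdempotent_mem_centralIdempotents (i : ι) :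
    blockIdempotent ψ i ∈ centralIdempotents A := by
  refine ⟨blockIdempotent_mem ψ i, ?_, fun a ha => ?_⟩
  · have : (ψ.symm (Pi.single i 1) * ψ.symm (Pi.single i 1) : A) = ψ.symm (Pi.single i 1) := by
      rw [← map_mul, ← Pi.single_mul, one_mul]
    exact congrArg Subtype.val this
  · have : (⟨a, ha⟩ * ψ.symm (Pi.single i 1) : A) = ψ.symm (Pi.single i 1) * ⟨a, ha⟩ := by
      apply ψ.injective
      rw [map_mul, map_mul, AlgEquiv.apply_symm_apply]
      ext1 j
      by_cases hj : j = i
      · subst hj; simp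
      · simp [Pi.single_eq_of_ne hj]
    exact congrArg Subtype.val this

/-- A central idempotent has every component equal to `0` or to `1`. -/
theorem apply_eq_zero_or_one_of_mem_centralIdempotents {P : M} (hP : P ∈ centralIdempotents A)
    (i : ι) : ψ ⟨P, hP.1⟩ i = 0 ∨ ψ ⟨P, hP.1⟩ i = 1 := by
  apply Matrix.eq_zero_or_eq_one_of_central_idempotent
  · rw [← Pi.mul_apply, ← map_mul]
    exact congrArg (fun x => ψ x i) (Subtype.ext hP.2.1)
  · intro a
    have h : (ψ.symm (Pi.single i a) * ⟨P, hP.1⟩ : A) = ⟨P, hP.1⟩ * ψ.symm (Pi.single i a) :=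
      Subtype.ext (hP.2.2 _ (Subtype.property _))
    have := congrArg (fun x => ψ x i) h
    simpa using this

/-- For a central idempotent `Q`, the product `Q P_i` vanishes or equals `P_i`. -/
theorem mul_blockIdempotent_eq {Q : M} (hQ : Q ∈ centralIdempotents A) (i : ι) :
    Q * blockIdempotent ψ i = 0 ∨ Q * blockIdempotent ψ i = blockIdempotent ψ i := by
  have h : ψ (⟨Q, hQ.1⟩ * ψ.symm (Pi.single i 1)) = Pi.single i (ψ ⟨Q, hQ.1⟩ i) := by
    rw [map_mul, AlgEquiv.apply_symm_apply]
    ext1 j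
    by_cases hj : j = i
    · subst hj; simp
    · simp [Pi.single_eq_of_ne hj]
  rcases apply_eq_zero_or_one_of_mem_centralIdempotents ψ hQ i with h0 | h0 <;> rw [h0] at h
  · left
    rw [Pi.single_zero, map_eq_zero_iff ψ ψ.injective] at h
    exact congrArg Subtype.val h
  · right
    exact congrArg Subtype.val (ψ.injective (h.trans (ψ.apply_symm_apply _).symm))

theorem mem_centralPrimitiveIdempotents_iff {P : M} :
    P ∈ centralPrimitiveIdempotents A ↔ ∃ i, 0 < d i ∧ blockIdempotent ψ i = P := by
  constructor
  · rintro ⟨hP, hP0, hprim⟩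
    have hne : (⟨P, hP.1⟩ : A) ≠ 0 := fun h => hP0 (congrArg Subtype.val h)
    obtain ⟨i, hi⟩ := Function.ne_iff.1 ((map_ne_zero_iff ψ ψ.injective).2 hne)
    have hi1 := (apply_eq_zero_or_one_of_mem_centralIdempotents ψ hP i).resolve_left hi
    have hd : 0 < d i := by
      by_contra h
      have h0 : d i = 0 := by omega
      have : IsEmpty (Fin (d i)) := by rw [h0]; infer_instance
      exact hi (Subsingleton.elim _ _)
    have hi0 := blockIdempotent_ne_zero ψ hd
    set Q := blockIdempotent ψ i with hQ
    have hQm : Q ∈ centralIdempotents A := blockIdempotent_mem_centralIdempotents ψ i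
    have hPQ : P * Q = Q := by
      refine (mul_blockIdempotent_eq ψ hP i).resolve_left fun h => hi ?_
      have : (⟨P, hP.1⟩ * ψ.symm (Pi.single i 1) : A) = 0 := Subtype.ext h
      have := congrArg (fun x => ψ x i) this
      simpa using this
    have hQP : Q * P = Q := by rw [hQm.2.2 P hP.1 |>.symm, hPQ]
    refine ⟨i, hd, ?_⟩
    have hR : P - Q ∈ centralIdempotents A :=
      ⟨sub_mem hP.1 hQm.1, by simp [mul_sub, sub_mul, hPQ, hQP, hP.2.1, hQm.2.1],
        fun a ha => by rw [mul_sub, sub_mul, hP.2.2 a ha, hQm.2.2 a ha]⟩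
    rcases hprim Q hQm (P - Q) hR (by rw [mul_sub, hQP, hQm.2.1, sub_self]) (by abel) with h | h
    · exact absurd h hi0
    · exact (sub_eq_zero.1 h).symm
  · rintro ⟨i, hd, rfl⟩
    refine ⟨blockIdempotent_mem_centralIdempotents ψ i, blockIdempotent_ne_zero ψ hd, ?_⟩
    intro Q₁ h₁ Q₂ h₂ h0 hsum
    have e₁ : Q₁ * blockIdempotent ψ i = Q₁ := by rw [hsum, mul_add, h0, h₁.2.1, add_zero]
    have e₂ : Q₂ * blockIdempotent ψ i = Q₂ := by
      rw [hsum, mul_add, h₂.2.1, h₁.2.2 Q₂ h₂.1, h0, zero_add]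
    rcases mul_blockIdempotent_eq ψ h₁ i with h | h
    · exact Or.inl (e₁.symm.trans h)
    · right
      have : Q₁ = Q₁ + Q₂ := (e₁.symm.trans h).trans hsum
      exact left_eq_add.1 this

theorem idempotentDegree_blockIdempotent {i : ι} (hi : 0 < d i) :
    idempotentDegree A (blockIdempotent ψ i) = d i := by
  refine idempotentDegree_eq hi ?_
  have hmem : ∀ x : blockIdeal A (blockIdempotent ψ i), (x : M) ∈ A := by
    rintro ⟨_, a, ha, rfl⟩
    exact mul_mem (show a ∈ A from ha) (blockIdempotent_mem ψ i)
  have hsing : ∀ x : blockIdeal A (blockIdempotent ψ i),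
      ψ ⟨x, hmem x⟩ = Pi.single i (ψ ⟨x, hmem x⟩ i) := by
    rintro ⟨_, a, ha, rfl⟩
    have : ψ (⟨a, ha⟩ * ψ.symm (Pi.single i 1)) =
        Pi.single i (ψ (⟨a, ha⟩ * ψ.symm (Pi.single i 1)) i) := by
      rw [map_mul, AlgEquiv.apply_symm_apply]
      ext1 j
      by_cases hj : j = i
      · subst hj; simp
      · simp [Pi.single_eq_of_ne hj]
    exact this
  refine ⟨
    { toFun := fun x => ψ ⟨x, hmem x⟩ i
      map_add' := fun x y => by rw [← Pi.add_apply, ← map_add]; rfl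
      map_smul' := fun c x => by rw [RingHom.id_apply, ← Pi.smul_apply, ← map_smul]; rfl
      invFun := fun m => ⟨(ψ.symm (Pi.single i m) : A), (ψ.symm (Pi.single i m) : A),
        Subtype.property _, by
          change ((ψ.symm (Pi.single i m) * ψ.symm (Pi.single i 1) : A) : M) = _
          rw [← map_mul, ← Pi.single_mul, mul_one]⟩
      left_inv := fun x => Subtype.ext <| by
        change ((ψ.symm (Pi.single i (ψ ⟨x, hmem x⟩ i)) : A) : M) = x
        rw [← hsing, AlgEquiv.symm_apply_apply]
      right_inv := fun m => by simp }, ?_⟩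
  intro x y z h
  change ψ ⟨z, hmem z⟩ i = ψ ⟨x, hmem x⟩ i * ψ ⟨y, hmem y⟩ i
  rw [← Pi.mul_apply, ← map_mul]
  exact congrArg (fun t => ψ t i) (Subtype.ext h)

end Blocks

/-! ### Corners -/

/-- Let `A` be isomorphic to a sum of matrix algebras, and let `J`, `K` be matrices with `K J = 1`
such that `a ↦ J a K` and `a ↦ K a J` exchange `A'` and the corner of `A` at the idempotent
`J K`. Then `A'` is the sum of the matrix algebras whose sizes are the ranks of the components of
`J K`, and its block idempotents are those of `A` carried over by `a ↦ K a J`. -/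
theorem exists_algEquiv_corner {V X ι : Type*} [Fintype V] [DecidableEq V] [Fintype X]
    [DecidableEq X] [DecidableEq ι] {d : ι → ℕ} {A : Subalgebra ℂ (Matrix V V ℂ)}
    {A' : Subalgebra ℂ (Matrix X X ℂ)} (J : Matrix V X ℂ) (K : Matrix X V ℂ) (hKJ : K * J = 1)
    (E : A) (hJK : J * K = E) (hA' : ∀ a ∈ A', J * a * K ∈ A) (hA : ∀ a ∈ A, K * a * J ∈ A')
    (ψ : A ≃ₐ[ℂ] Π i, Matrix (Fin (d i)) (Fin (d i)) ℂ) :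
    ∃ ψ' : A' ≃ₐ[ℂ] Π i, Matrix (Fin (ψ E i).rank) (Fin (ψ E i).rank) ℂ,
      ∀ i, blockIdempotent ψ' i = K * blockIdempotent ψ i * J := by
  have hJK2 : (J * K) * (J * K) = J * K := by
    rw [Matrix.mul_assoc, ← Matrix.mul_assoc K, hKJ, Matrix.one_mul]
  have hE3 : E * E = E := Subtype.ext <| by rw [MulMemClass.coe_mul, ← hJK, hJK2]
  have hE2 : ∀ i, ψ E i * ψ E i = ψ E i := fun i => by
    rw [← Pi.mul_apply, ← map_mul]
    exact congrArg (fun t => ψ t i) (hE3)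
  choose B C hCB hBC using fun i => Matrix.exists_factor_of_isIdempotentElem (hE2 i)
  have hBCB : ∀ i, ψ E i * B i = B i := fun i => by
    calc _ = (B i * C i) * B i := by rw [hBC]
      _ = B i := by rw [Matrix.mul_assoc, hCB, Matrix.mul_one]
  have hCBC : ∀ i, C i * ψ E i = C i := fun i => by
    calc _ = C i * (B i * C i) := by rw [hBC]
      _ = C i := by rw [← Matrix.mul_assoc, hCB, Matrix.one_mul]
  let u : A' → A := fun a => ⟨J * (a : Matrix X X ℂ) * K, hA' _ a.2⟩
  have hu : ∀ a b, u (a * b) = u a * u b := fun a b => Subtype.ext <| by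
    change J * (a.1 * b.1) * K = (J * a.1 * K) * (J * b.1 * K)
    calc _ = J * a.1 * (1 : Matrix X X ℂ) * b.1 * K := by
          simp only [Matrix.mul_assoc, Matrix.one_mul]
      _ = _ := by rw [← hKJ]; simp only [Matrix.mul_assoc]
  have hEu : ∀ a, E * u a * E = u a := fun a => Subtype.ext <| by
    change E.1 * (J * a.1 * K) * E.1 = J * a.1 * K
    rw [← hJK]
    calc _ = J * (K * J) * a.1 * (K * J) * K := by simp only [Matrix.mul_assoc]
      _ = _ := by rw [hKJ, Matrix.mul_one, Matrix.mul_one]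
  have hEui : ∀ a i, B i * (C i * ψ (u a) i * B i) * C i = ψ (u a) i := fun a i => by
    calc _ = (B i * C i) * ψ (u a) i * (B i * C i) := by simp only [Matrix.mul_assoc]
      _ = _ := by
        rw [hBC]
        have := congrArg (fun t => ψ t i) (hEu a)
        simpa only [map_mul, Pi.mul_apply] using this
  have huadd : ∀ a b, u (a + b) = u a + u b := fun a b => Subtype.ext <| by
    simp [u, Matrix.mul_add, Matrix.add_mul]
  have husmul : ∀ (c : ℂ) a, u (c • a) = c • u a := fun c a => Subtype.ext <| by
    simp [u]
  let f : A' →ₗ[ℂ] Π i, Matrix (Fin (ψ E i).rank) (Fin (ψ E i).rank) ℂ :=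
    { toFun := fun a i => C i * ψ (u a) i * B i
      map_add' := fun a b => by
        ext1 i; rw [huadd, map_add, Pi.add_apply, Pi.add_apply, Matrix.mul_add, Matrix.add_mul]
      map_smul' := fun c a => by
        ext1 i; rw [husmul, map_smul]; simp }
  let g : A' →ₐ[ℂ] Π i, Matrix (Fin (ψ E i).rank) (Fin (ψ E i).rank) ℂ :=
    AlgHom.ofLinearMap f
      (by
        ext1 i
        have : u 1 = E := Subtype.ext <| by simp [u, hJK]
        change C i * ψ (u 1) i * B i = 1
        rw [this, hCBC, hCB])
      (fun a b => by
        ext1 i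
        change C i * ψ (u (a * b)) i * B i = (C i * ψ (u a) i * B i) * (C i * ψ (u b) i * B i)
        rw [hu, map_mul, Pi.mul_apply]
        calc _ = C i * ((B i * (C i * ψ (u a) i * B i) * C i) * ψ (u b) i) * B i := by rw [hEui]
          _ = (C i * B i) * (C i * ψ (u a) i * B i) * (C i * ψ (u b) i * B i) := by
            simp only [Matrix.mul_assoc]
          _ = _ := by rw [hCB, Matrix.one_mul])
  have hg : ∀ a i, g a i = C i * ψ (u a) i * B i := fun _ _ => rfl
  have hginj : Function.Injective g := by
    intro a b hab
    have h1 : u a = u b := ψ.injective <| by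
      ext1 i
      rw [← hEui a i, ← hEui b i, ← hg a i, ← hg b i, hab]
    apply Subtype.ext
    have h2 : J * a.1 * K = J * b.1 * K := congrArg Subtype.val h1
    have h3 : ∀ x : Matrix X X ℂ, K * (J * x * K) * J = x := fun x => by
      calc _ = (K * J) * x * (K * J) := by simp only [Matrix.mul_assoc]
        _ = x := by rw [hKJ, Matrix.mul_one, Matrix.one_mul]
    rw [← h3 a.1, h2, h3]
  -- Compressing an element of `A` to the corner compresses each of its components.
  have hcomp : ∀ x : A, ∀ i, g ⟨K * x.1 * J, hA _ x.2⟩ i = C i * ψ x i * B i := fun x i => by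
    have : u ⟨K * x.1 * J, hA _ x.2⟩ = E * x * E := Subtype.ext <| by
      change J * (K * x.1 * J) * K = E.1 * x.1 * E.1
      rw [← hJK]
      simp only [Matrix.mul_assoc]
    rw [hg, this, map_mul, map_mul, Pi.mul_apply, Pi.mul_apply]
    calc _ = (C i * ψ E i) * ψ x i * (ψ E i * B i) := by
          simp only [Matrix.mul_assoc]
      _ = _ := by rw [hCBC, hBCB]
  have hgsurj : Function.Surjective g := by
    intro y
    refine ⟨⟨K * (ψ.symm fun i => B i * y i * C i : A).1 * J, hA _ (Subtype.property _)⟩, ?_⟩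
    ext1 i
    rw [hcomp, AlgEquiv.apply_symm_apply]
    calc _ = (C i * B i) * y i * (C i * B i) := by simp only [Matrix.mul_assoc]
      _ = _ := by rw [hCB, Matrix.mul_one, Matrix.one_mul]
  refine ⟨AlgEquiv.ofBijective g ⟨hginj, hgsurj⟩, fun i => ?_⟩
  have h : (AlgEquiv.ofBijective g ⟨hginj, hgsurj⟩).symm (Pi.single i 1) =
      ⟨K * blockIdempotent ψ i * J, hA _ (blockIdempotent_mem ψ i)⟩ := by
    rw [AlgEquiv.symm_apply_eq]
    ext1 j
    change _ = g _ j
    rw [hcomp ⟨_, blockIdempotent_mem ψ i⟩, apply_blockIdempotent]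
    by_cases hj : j = i
    · subst hj; rw [Pi.single_eq_same, Pi.single_eq_same, Matrix.mul_one, hCB]
    · rw [Pi.single_eq_of_ne hj, Pi.single_eq_of_ne hj, Matrix.mul_zero, Matrix.zero_mul]
  exact congrArg Subtype.val h

/-! ### Self-adjoint matrix algebras -/

open scoped ComplexOrder in
theorem Matrix.eq_zero_of_isHermitian_of_isNilpotent {n : Type*} [Fintype n] [DecidableEq n]
    {h : Matrix n n ℂ} (hh : h.IsHermitian) (hn : IsNilpotent h) : h = 0 := by
  have key : ∀ k : ℕ, h ^ (2 ^ k) = 0 → h = 0 := by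
    intro k
    induction k with
    | zero => simp
    | succ k ih =>
      intro hk
      apply ih
      rw [← Matrix.conjTranspose_mul_self_eq_zero, Matrix.conjTranspose_pow, hh.eq, ← pow_add,
        ← two_mul, ← pow_succ', hk]
  obtain ⟨k, hk⟩ := hn
  exact key k (pow_eq_zero_of_le Nat.lt_two_pow_self.le hk)

open scoped ComplexOrder in
/-- The Jacobson radical of `A` is nilpotent, and for `a` in it `aᴴ a` is a nilpotent Hermitian
matrix of the radical, hence zero. -/
theorem isSemisimpleRing_of_conjTranspose_mem {n : Type*} [Fintype n] [DecidableEq n]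
    (A : Subalgebra ℂ (Matrix n n ℂ)) (hA : ∀ a ∈ A, a.conjTranspose ∈ A) :
    IsSemisimpleRing A := by
  have : IsArtinianRing A := IsArtinianRing.of_finite ℂ A
  rw [IsArtinianRing.isSemisimpleRing_iff_jacobson, eq_bot_iff]
  rintro ⟨a, ha⟩ haJ
  rw [Submodule.mem_bot]
  apply Subtype.ext
  rw [ZeroMemClass.coe_zero, ← Matrix.conjTranspose_mul_self_eq_zero]
  apply Matrix.eq_zero_of_isHermitian_of_isNilpotent (Matrix.isHermitian_conjTranspose_mul_self a)
  obtain ⟨k, hk⟩ := IsSemiprimaryRing.isNilpotent (R := A)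
  have hmem : (⟨a.conjTranspose, hA a ha⟩ * ⟨a, ha⟩ : A) ∈ Ring.jacobson A :=
    Ideal.mul_mem_left _ _ haJ
  have h := Ideal.pow_mem_pow hmem k
  rw [hk] at h
  exact ⟨k, congrArg Subtype.val (show (⟨a.conjTranspose, hA a ha⟩ * ⟨a, ha⟩ : A) ^ k = 0 from h)⟩

namespace CoherentConfiguration

/-! ### Fibers and the corners they cut out -/

section Corners

variable {V : Type*} [Finite V] {C : CoherentConfiguration V}

/-- A basis relation that meets `X × Y`, for fibers `X` and `Y`, is contained in it. -/
theorem mem_relBetween_of_mem {X Y : Finset V} (hX : X ∈ C.fibers) (hY : Y ∈ C.fibers)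
    {R : Set (V × V)} (hR : R ∈ C.rel) {p : V × V} (hp : p ∈ R) (h₁ : p.1 ∈ X) (h₂ : p.2 ∈ Y) :
    R ∈ C.relBetween X Y := by
  refine ⟨hR, fun q hq => ⟨?_, ?_⟩⟩
  · have h := C.coherent _ hX.2 R hR R hR p hp q hq
    have hpos : 0 < {w : V | (p.1, w) ∈ diag X ∧ (w, p.2) ∈ R}.ncard :=
      (Set.ncard_pos (Set.toFinite _)).2 ⟨p.1, ⟨h₁, rfl⟩, hp⟩
    rw [h] at hpos
    obtain ⟨w, hw, -⟩ := (Set.ncard_pos (Set.toFinite _)).1 hpos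
    exact hw.1
  · have h := C.coherent R hR _ hY.2 R hR p hp q hq
    have hpos : 0 < {w : V | (p.1, w) ∈ R ∧ (w, p.2) ∈ diag Y}.ncard :=
      (Set.ncard_pos (Set.toFinite _)).2 ⟨p.2, hp, ⟨h₂, rfl⟩⟩
    rw [h] at hpos
    obtain ⟨w, -, hw⟩ := (Set.ncard_pos (Set.toFinite _)).1 hpos
    obtain ⟨ha, hb⟩ := hw
    simp only at ha hb
    exact hb ▸ ha

/-- Every point lies in exactly one fiber. -/
theorem existsUnique_fiber (C : CoherentConfiguration V) (v : V) :
    ∃! X : C.fibers, v ∈ (X : Finset V) := by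
  classical
  cases nonempty_fintype V
  obtain ⟨D, hD, hDu⟩ := C.diagonal
  obtain ⟨T, hT, hvT⟩ : (v, v) ∈ ⋃₀ D := by rw [hDu]; rfl
  have hTd : ∀ p ∈ T, p.1 = p.2 := fun p hp => by
    have : p ∈ Set.diagonal V := hDu ▸ ⟨T, hT, hp⟩
    exact this
  let X : Finset V := Finset.univ.filter fun u => (u, u) ∈ T
  have hXT : diag X = T := by
    ext ⟨a, b⟩
    constructor
    · rintro ⟨h, rfl : a = b⟩
      simpa [X] using h
    · intro h
      obtain rfl : a = b := hTd _ h
      exact ⟨by simpa [X] using h, rfl⟩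
  refine ⟨⟨X, ⟨v, by simpa [X] using hvT⟩, hXT ▸ hD hT⟩, by simpa [X] using hvT, ?_⟩
  rintro ⟨Y, hY⟩ (hvY : v ∈ Y)
  apply Subtype.ext
  have hYT : diag Y = T := eq_of_mem hY.2 (hD hT) ⟨hvY, rfl⟩ hvT
  ext u
  have : (u, u) ∈ diag Y ↔ (u, u) ∈ diag X := by rw [hYT, hXT]
  simpa [diag] using this

/-- The adjacency matrices of a set of basis relations are linearly independent. -/
theorem finrank_span_adjMatrix {D : Set (Set (V × V))} (hD : D ⊆ C.rel) :
    Module.finrank ℂ (Submodule.span ℂ (adjMatrix '' D)) = D.ncard := by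
  classical
  cases nonempty_fintype V
  have : Fintype D := Fintype.ofFinite D
  have hli : LinearIndependent ℂ fun R : D => adjMatrix (R : Set (V × V)) := by
    rw [Fintype.linearIndependent_iff]
    intro g hg R
    obtain ⟨⟨u, v⟩, huv⟩ : (R : Set (V × V)).Nonempty :=
      Set.nonempty_iff_ne_empty.2 fun h => C.isPartition.1 (h ▸ hD R.2)
    have h := congrFun (congrFun hg u) v
    rw [Matrix.sum_apply, Finset.sum_eq_single R] at h
    · simpa [adjMatrix_apply, huv] using h
    · intro S _ hSR
      have : (u, v) ∉ (S : Set (V × V)) := fun h =>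
        hSR (Subtype.ext (eq_of_mem (hD S.2) (hD R.2) h huv))
      simp [adjMatrix_apply, this]
    · simp
  rw [Set.image_eq_range, finrank_span_eq_card hli, ← Nat.card_eq_fintype_card,
    Nat.card_coe_set_eq]

end Corners

variable {V : Type*} [Fintype V] [DecidableEq V] (C : CoherentConfiguration V)

theorem adjMatrix_mem {R : Set (V × V)} (hR : R ∈ C.rel) : adjMatrix R ∈ C.adjacencyAlgebra :=
  Submodule.subset_span ⟨R, hR, rfl⟩

/-- The adjacency algebra is spanned by the adjacency matrices. -/
theorem adjacencyAlgebra_induction {p : Matrix V V ℂ → Prop}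
    (hp : ∀ R ∈ C.rel, p (adjMatrix R)) (zero : p 0) (add : ∀ a b, p a → p b → p (a + b))
    (smul : ∀ (c : ℂ) a, p a → p (c • a)) {a : Matrix V V ℂ} (ha : a ∈ C.adjacencyAlgebra) :
    p a := by
  have ha' : a ∈ Submodule.span ℂ (adjMatrix '' C.rel) := ha
  refine Submodule.span_induction (p := fun x _ => p x) ?_ zero (fun a b _ _ => add a b)
    (fun c a _ => smul c a) ha'
  rintro _ ⟨R, hR, rfl⟩
  exact hp R hR

theorem conjTranspose_mem_adjacencyAlgebra {a : Matrix V V ℂ} (ha : a ∈ C.adjacencyAlgebra) :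
    a.conjTranspose ∈ C.adjacencyAlgebra := by
  classical
  refine C.adjacencyAlgebra_induction (p := fun a => a.conjTranspose ∈ C.adjacencyAlgebra)
    ?_ ?_ ?_ ?_ ha
  · intro R hR
    have : (adjMatrix R).conjTranspose = adjMatrix {p : V × V | (p.2, p.1) ∈ R} := by
      ext u v
      rw [Matrix.conjTranspose_apply, adjMatrix_apply, adjMatrix_apply]
      by_cases h : (v, u) ∈ R <;> simp [h]
    rw [this]
    exact C.adjMatrix_mem (C.transpose R hR)
  · rw [Matrix.conjTranspose_zero]; exact zero_mem _
  · intro a b ha hb; rw [Matrix.conjTranspose_add]; exact add_mem ha hb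
  · intro c a ha; rw [Matrix.conjTranspose_smul]; exact Subalgebra.smul_mem _ ha _

instance : IsSemisimpleRing C.adjacencyAlgebra :=
  isSemisimpleRing_of_conjTranspose_mem _ fun _ => C.conjTranspose_mem_adjacencyAlgebra

/-- The matrix `I_X`, as an element of the adjacency algebra. -/
noncomputable def fiberIdempotent (X : C.fibers) : C.adjacencyAlgebra :=
  ⟨adjMatrix (diag (X : Finset V)), C.adjMatrix_mem X.2.2⟩

theorem adjMatrix_diag {V : Type*} [DecidableEq V] (X : Finset V) :
    adjMatrix (diag X) = Matrix.diagonal fun v => if v ∈ X then (1 : ℂ) else 0 := by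
  classical
  ext u v
  rw [adjMatrix_apply, Matrix.diagonal_apply]
  by_cases h : u = v <;> by_cases h' : u ∈ X <;> simp [diag, h, h']

theorem adjMatrix_diag_mul_mul_apply (X Y : Finset V) (a : Matrix V V ℂ) (u v : V) :
    (adjMatrix (diag X) * a * adjMatrix (diag Y)) u v = if u ∈ X ∧ v ∈ Y then a u v else 0 := by
  rw [adjMatrix_diag, adjMatrix_diag, Matrix.mul_diagonal, Matrix.diagonal_mul]
  by_cases h : u ∈ X <;> by_cases h' : v ∈ Y <;> simp [h, h']

theorem fiberIdempotent_mul_self (X : C.fibers) :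
    C.fiberIdempotent X * C.fiberIdempotent X = C.fiberIdempotent X := Subtype.ext <| by
  change adjMatrix (diag (X : Finset V)) * adjMatrix (diag (X : Finset V)) = adjMatrix _
  rw [adjMatrix_diag, Matrix.diagonal_mul_diagonal]
  simp

theorem sum_fiberIdempotent [Fintype C.fibers] : ∑ X, C.fiberIdempotent X = 1 := by
  apply Subtype.ext
  rw [AddSubmonoidClass.coe_finsetSum, OneMemClass.coe_one]
  have : ∀ X : C.fibers, (C.fiberIdempotent X : Matrix V V ℂ) =
      Matrix.diagonal fun v => if v ∈ (X : Finset V) then (1 : ℂ) else 0 :=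
    fun X => adjMatrix_diag _
  ext u v
  rw [Matrix.sum_apply]
  simp only [this, Matrix.diagonal_apply, Matrix.one_apply]
  split_ifs with huv
  · obtain ⟨X, hX, huniq⟩ := existsUnique_fiber C u
    rw [Finset.sum_eq_single X, if_pos hX]
    · intro Y _ hY
      exact if_neg fun h => hY (huniq Y h)
    · simp
  · simp

/-- The corner `I_X A I_Y` of the adjacency algebra is spanned by the adjacency matrices of the
basis relations between `X` and `Y`. -/
theorem mem_span_relBetween_iff (X Y : C.fibers) (a : C.adjacencyAlgebra) :
    (a : Matrix V V ℂ) ∈ Submodule.span ℂ (adjMatrix '' C.relBetween X Y) ↔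
      C.fiberIdempotent X * a * C.fiberIdempotent Y = a := by
  classical
  have hcoe : C.fiberIdempotent X * a * C.fiberIdempotent Y = a ↔
      adjMatrix (diag (X : Finset V)) * a.1 * adjMatrix (diag (Y : Finset V)) = a.1 :=
    Subtype.ext_iff
  have hin : ∀ R ∈ C.relBetween X Y, adjMatrix (diag (X : Finset V)) * adjMatrix R *
      adjMatrix (diag (Y : Finset V)) = adjMatrix R := by
    rintro R ⟨-, hR⟩
    ext u v
    rw [adjMatrix_diag_mul_mul_apply]
    split_ifs with h
    · rfl
    · rw [adjMatrix_apply, if_neg fun huv => h (hR huv)]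
  rw [hcoe]
  constructor
  · intro h
    refine Submodule.span_induction (p := fun x _ => adjMatrix (diag (X : Finset V)) * x *
      adjMatrix (diag (Y : Finset V)) = x) ?_ (by simp) ?_ ?_ h
    · rintro _ ⟨R, hR, rfl⟩
      exact hin R hR
    · intro x y _ _ hx hy
      rw [Matrix.mul_add, Matrix.add_mul, hx, hy]
    · intro c x _ hx
      rw [Matrix.mul_smul, Matrix.smul_mul, hx]
  · intro h
    rw [← h]
    refine C.adjacencyAlgebra_induction (p := fun x => adjMatrix (diag (X : Finset V)) * x *
      adjMatrix (diag (Y : Finset V)) ∈ Submodule.span ℂ (adjMatrix '' C.relBetween X Y))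
      ?_ (by simp) ?_ ?_ a.2
    · intro R hR
      by_cases hRXY : R ∈ C.relBetween X Y
      · rw [hin R hRXY]
        exact Submodule.subset_span ⟨R, hRXY, rfl⟩
      · have : adjMatrix (diag (X : Finset V)) * adjMatrix R *
            adjMatrix (diag (Y : Finset V)) = 0 := by
          ext u v
          rw [adjMatrix_diag_mul_mul_apply]
          split_ifs with h
          · rw [adjMatrix_apply, if_neg fun huv =>
              hRXY (mem_relBetween_of_mem X.2 Y.2 hR huv h.1 h.2), Matrix.zero_apply]
          · rfl
        rw [this]
        exact zero_mem _
    · intro x y hx hy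
      rw [Matrix.mul_add, Matrix.add_mul]
      exact add_mem hx hy
    · intro c x hx
      rw [Matrix.mul_smul, Matrix.smul_mul]
      exact Submodule.smul_mem _ _ hx

/-! ### The adjacency algebra of a homogeneous component -/

/-- The `V × X` matrix of the inclusion of `X` in `V`. -/
def inclusionMatrix (X : Finset V) : Matrix V X ℂ := (1 : Matrix V V ℂ).submatrix id Subtype.val

theorem transpose_inclusionMatrix_mul_mul (X : Finset V) (a : Matrix V V ℂ) :
    (inclusionMatrix X).transpose * a * inclusionMatrix X =
      a.submatrix Subtype.val Subtype.val := by
  ext x y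
  simp [inclusionMatrix, Matrix.mul_apply, Matrix.one_apply]

theorem transpose_inclusionMatrix_mul_self (X : Finset V) :
    (inclusionMatrix X).transpose * inclusionMatrix X = 1 := by
  have h := transpose_inclusionMatrix_mul_mul X 1
  rw [Matrix.mul_one] at h
  rw [h]
  exact Matrix.submatrix_one _ Subtype.val_injective

theorem inclusionMatrix_mul_mul_transpose {V : Type*} [DecidableEq V] (X : Finset V)
    (S : Set (X × X)) :
    inclusionMatrix X * adjMatrix S * (inclusionMatrix X).transpose = adjMatrix (extend X S) := by
  classical
  ext u v
  simp only [inclusionMatrix, Matrix.mul_apply, Matrix.one_apply, Matrix.transpose_apply,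
    Matrix.submatrix_apply, id, adjMatrix_apply, extend, Set.mem_ofPred_eq]
  by_cases hu : u ∈ X
  · by_cases hv : v ∈ X
    · rw [Finset.sum_eq_single ⟨v, hv⟩, Finset.sum_eq_single ⟨u, hu⟩] <;> simp [hu, hv] <;> grind
    · rw [Finset.sum_eq_zero]
      · simp [hv]
      · rintro y -
        rw [if_neg, mul_zero]
        rintro rfl
        exact hv y.2
  · rw [Finset.sum_eq_zero]
    · simp [hu]
    · rintro y -
      rw [Finset.sum_eq_zero, zero_mul]
      rintro x -
      rw [if_neg, zero_mul]
      rintro rfl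
      exact hu x.2

theorem inclusionMatrix_mul_transpose {V : Type*} [DecidableEq V] (X : Finset V) :
    inclusionMatrix X * (inclusionMatrix X).transpose = adjMatrix (diag X) := by
  classical
  have h := inclusionMatrix_mul_mul_transpose X (Set.diagonal X)
  have h1 : adjMatrix (Set.diagonal X) = (1 : Matrix X X ℂ) := by
    ext x y
    rw [adjMatrix_apply, Matrix.one_apply]
    rfl
  rw [h1, Matrix.mul_one] at h
  rw [h]
  congr 1
  ext ⟨u, v⟩
  simp only [extend, diag, Set.mem_ofPred_eq, Set.mem_diagonal_iff, Subtype.mk.injEq]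
  constructor
  · rintro ⟨h₁, -, h⟩
    exact ⟨h₁, h⟩
  · rintro ⟨h₁, rfl⟩
    exact ⟨h₁, h₁, rfl⟩

theorem idempotentAt_eq (X : Finset V) (P : Matrix V V ℂ) :
    idempotentAt X P = (inclusionMatrix X).transpose * P * inclusionMatrix X := by
  rw [idempotentAt, ← transpose_inclusionMatrix_mul_mul, ← inclusionMatrix_mul_transpose]
  simp only [Matrix.mul_assoc]
  rw [transpose_inclusionMatrix_mul_self, Matrix.mul_one]

theorem inclusionMatrix_mul_mul_transpose_mem (X : C.fibers)
    {a : Matrix (X : Finset V) (X : Finset V) ℂ}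
    (ha : a ∈ (C.component X X.2).adjacencyAlgebra) :
    inclusionMatrix (X : Finset V) * a * (inclusionMatrix (X : Finset V)).transpose ∈
      C.adjacencyAlgebra := by
  refine (C.component X X.2).adjacencyAlgebra_induction
    (p := fun a => inclusionMatrix (X : Finset V) * a * (inclusionMatrix (X : Finset V)).transpose ∈
      C.adjacencyAlgebra) ?_ ?_ ?_ ?_ ha
  · intro S hS
    rw [inclusionMatrix_mul_mul_transpose]
    exact C.adjMatrix_mem hS.1
  · simp
  · intro a b ha hb
    rw [Matrix.mul_add, Matrix.add_mul]
    exact add_mem ha hb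
  · intro c a ha
    rw [Matrix.mul_smul, Matrix.smul_mul]
    exact Subalgebra.smul_mem _ ha _

theorem transpose_inclusionMatrix_mul_mul_mem (X : C.fibers) {a : Matrix V V ℂ}
    (ha : a ∈ C.adjacencyAlgebra) :
    (inclusionMatrix (X : Finset V)).transpose * a * inclusionMatrix (X : Finset V) ∈
      (C.component X X.2).adjacencyAlgebra := by
  classical
  refine C.adjacencyAlgebra_induction
    (p := fun a => (inclusionMatrix (X : Finset V)).transpose * a * inclusionMatrix (X : Finset V) ∈
      (C.component X X.2).adjacencyAlgebra) ?_ ?_ ?_ ?_ ha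
  · intro R hR
    rw [transpose_inclusionMatrix_mul_mul]
    let S : Set (↥X.1 × ↥X.1) := {p | ((p.1 : V), (p.2 : V)) ∈ R}
    have hS : (adjMatrix R).submatrix Subtype.val Subtype.val = adjMatrix S := by
      ext x y
      simp [adjMatrix_apply, S]
    rw [hS]
    by_cases hRX : R ∈ C.relBetween X X
    · apply (C.component X X.2).adjMatrix_mem
      have : extend (X : Finset V) S = R := by
        ext p
        constructor
        · rintro ⟨_, _, h⟩
          exact h
        · exact fun hp => ⟨(hRX.2 hp).1, (hRX.2 hp).2, hp⟩
      change extend (X : Finset V) S ∈ C.relBetween X X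
      rwa [this]
    · have : adjMatrix S = 0 := by
        ext x y
        have hxy : (x, y) ∉ S := fun h =>
          hRX (mem_relBetween_of_mem X.2 X.2 hR (p := ((x : V), (y : V))) h x.2 y.2)
        rw [adjMatrix_apply, if_neg hxy, Matrix.zero_apply]
      rw [this]
      exact zero_mem _
  · simp
  · intro a b ha hb
    rw [Matrix.mul_add, Matrix.add_mul]
    exact add_mem ha hb
  · intro c a ha
    rw [Matrix.mul_smul, Matrix.smul_mul]
    exact Subalgebra.smul_mem _ ha _

/-! ### Block ranks of the fibers -/

section BlockRank

variable {ι : Type*} {d : ι → ℕ}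
  (ψ : C.adjacencyAlgebra ≃ₐ[ℂ] Π i, Matrix (Fin (d i)) (Fin (d i)) ℂ)

/-- The rank of the component of `I_X` in the `i`-th summand of a decomposition of the adjacency
algebra into matrix algebras. -/
noncomputable def blockRank (X : C.fibers) (i : ι) : ℕ := (ψ (C.fiberIdempotent X) i).rank

theorem apply_fiberIdempotent_mul_self (X : C.fibers) :
    ψ (C.fiberIdempotent X) * ψ (C.fiberIdempotent X) = ψ (C.fiberIdempotent X) := by
  rw [← map_mul, fiberIdempotent_mul_self]

/-- The ranks are traces, and the matrices `I_X` add up to the identity. -/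
theorem sum_blockRank [Fintype C.fibers] (i : ι) : ∑ X, C.blockRank ψ X i = d i := by
  have h : ∑ X, ψ (C.fiberIdempotent X) i = 1 := by
    rw [← Finset.sum_apply, ← map_sum, sum_fiberIdempotent, map_one, Pi.one_apply]
  have h' := congrArg Matrix.trace h
  rw [Matrix.trace_sum, Matrix.trace_one, Fintype.card_fin] at h'
  have h'' : ((∑ X, C.blockRank ψ X i : ℕ) : ℂ) = (d i : ℂ) := by
    rw [← h', Nat.cast_sum]
    refine Finset.sum_congr rfl fun X _ => ?_
    exact (Matrix.trace_eq_rank_of_isIdempotentElem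
      (congrFun (C.apply_fiberIdempotent_mul_self ψ X) i)).symm
  exact_mod_cast h''

/-- The number of basis relations between two fibers is the dimension of the corner `I_X A I_Y`,
which is computed block by block. -/
theorem ncard_relBetween [Fintype ι] (X Y : C.fibers) :
    (C.relBetween X Y).ncard = ∑ i, C.blockRank ψ X i * C.blockRank ψ Y i := by
  let T := Submodule.span ℂ (adjMatrix '' C.relBetween X Y)
  let L : (Π i, Matrix (Fin (d i)) (Fin (d i)) ℂ) →ₗ[ℂ] Matrix V V ℂ :=
    C.adjacencyAlgebra.val.toLinearMap ∘ₗ ψ.symm.toLinearMap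
  have hL : Function.Injective L := Subtype.val_injective.comp ψ.symm.injective
  have hT : T ≤ LinearMap.range L := by
    intro a ha
    have ha' : a ∈ C.adjacencyAlgebra :=
      Submodule.span_mono (Set.image_mono fun R hR => hR.1) ha
    exact ⟨ψ ⟨a, ha'⟩, by simp [L]⟩
  rw [← finrank_span_adjMatrix (C := C) (D := C.relBetween X Y) fun R hR => hR.1]
  change Module.finrank ℂ T = _
  rw [← Submodule.map_comap_eq_self hT,
    ← (Submodule.equivMapOfInjective L hL (T.comap L)).finrank_eq]
  refine Matrix.finrank_corner_pi (ψ (C.fiberIdempotent X)) (ψ (C.fiberIdempotent Y))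
    (C.apply_fiberIdempotent_mul_self ψ X) (C.apply_fiberIdempotent_mul_self ψ Y) _ fun a => ?_
  refine (C.mem_span_relBetween_iff X Y (ψ.symm a)).trans ?_
  rw [← ψ.injective.eq_iff, map_mul, map_mul, AlgEquiv.apply_symm_apply]

/-- The adjacency algebra of the component at `X` is the sum of the matrix algebras whose sizes are
the block ranks of `X`, with block idempotents `P_X`. -/
theorem exists_algEquiv_component [DecidableEq ι] (X : C.fibers) :
    ∃ ψ' : (C.component X X.2).adjacencyAlgebra ≃ₐ[ℂ]
        Π i, Matrix (Fin (C.blockRank ψ X i)) (Fin (C.blockRank ψ X i)) ℂ,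
      ∀ i, blockIdempotent ψ' i = idempotentAt (X : Finset V) (blockIdempotent ψ i) := by
  obtain ⟨ψ', h⟩ := exists_algEquiv_corner (inclusionMatrix (X : Finset V))
    (inclusionMatrix (X : Finset V)).transpose (transpose_inclusionMatrix_mul_self _)
    (C.fiberIdempotent X) (inclusionMatrix_mul_transpose _)
    (fun _ => C.inclusionMatrix_mul_mul_transpose_mem X)
    (fun _ => C.transpose_inclusionMatrix_mul_mul_mem X) ψ
  exact ⟨ψ', fun i => (h i).trans (idempotentAt_eq _ _).symm⟩

/-- In a balanced scheme the block ranks do not depend on the fiber: if `r` is the common number of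
basis relations, then `∑ (r_i(X) - r_i(Y))² = r - 2 r + r = 0`. -/
theorem blockRank_eq_of_isBalanced [Fintype ι] (hC : C.IsBalanced) (X Y : C.fibers) (i : ι) :
    C.blockRank ψ X i = C.blockRank ψ Y i := by
  obtain ⟨r, -, hr⟩ := hC
  have key : ∀ X Y : C.fibers,
      ∑ i, (C.blockRank ψ X i : ℤ) * (C.blockRank ψ Y i : ℤ) = r := fun X Y => by
    rw [← hr X X.2 Y Y.2, C.ncard_relBetween ψ X Y]
    push_cast
    rfl
  have h0 : ∑ i, ((C.blockRank ψ X i : ℤ) - C.blockRank ψ Y i) ^ 2 = 0 := by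
    calc _ = ∑ i, ((C.blockRank ψ X i : ℤ) * C.blockRank ψ X i -
          2 * (C.blockRank ψ X i * C.blockRank ψ Y i) +
          C.blockRank ψ Y i * C.blockRank ψ Y i) := Finset.sum_congr rfl fun i _ => by ring
      _ = 0 := by
        rw [Finset.sum_add_distrib, Finset.sum_sub_distrib, ← Finset.mul_sum, key, key, key]
        ring
  have h1 := (Finset.sum_eq_zero_iff_of_nonneg fun i _ => sq_nonneg _).1 h0 i (Finset.mem_univ i)
  have h2 := sub_eq_zero.1 (pow_eq_zero_iff two_ne_zero |>.1 h1)
  exact_mod_cast h2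

end BlockRank

end CoherentConfiguration

open CoherentConfiguration in
theorem theorem1 {V : Type*} [Fintype V] [DecidableEq V] (C : CoherentConfiguration V) :
    C.IsBalanced ↔
      ∀ (X : Finset V) (hX : X ∈ C.fibers),
        Set.BijOn (fun P : Matrix V V ℂ => CoherentConfiguration.idempotentAt X P)
          C.idempotents (C.component X hX).idempotents ∧
        ∀ P ∈ C.idempotents,
          C.degree P =
            C.fibers.ncard *
              (C.component X hX).degree (CoherentConfiguration.idempotentAt X P) := by
  classical
  have : Fintype C.fibers := Fintype.ofFinite _
  obtain ⟨n, d, hd, ⟨ψ⟩⟩ :=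
    IsSemisimpleRing.exists_algEquiv_pi_matrix_of_isAlgClosed ℂ C.adjacencyAlgebra
  have hd : ∀ i, 0 < d i := fun i => Nat.pos_of_ne_zero (hd i).out
  have hcard : C.fibers.ncard = Fintype.card C.fibers := by
    rw [← Nat.card_coe_set_eq, Nat.card_eq_fintype_card]
  have hmem : ∀ P, P ∈ C.idempotents ↔ ∃ i, 0 < d i ∧ blockIdempotent ψ i = P := fun P =>
    mem_centralPrimitiveIdempotents_iff ψ
  constructor
  · intro hC X hX
    obtain ⟨ψ', hψ'⟩ := C.exists_algEquiv_component ψ ⟨X, hX⟩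
    have hdr : ∀ i, d i = C.fibers.ncard * C.blockRank ψ ⟨X, hX⟩ i := fun i => by
      rw [← C.sum_blockRank ψ i, hcard, Finset.sum_congr rfl fun Y _ =>
        C.blockRank_eq_of_isBalanced ψ hC Y ⟨X, hX⟩ i, Finset.sum_const, smul_eq_mul,
        Finset.card_univ]
    have hr : ∀ i, 0 < C.blockRank ψ ⟨X, hX⟩ i := fun i =>
      Nat.pos_of_mul_pos_left ((hdr i) ▸ hd i)
    refine ⟨⟨?_, ?_, ?_⟩, ?_⟩
    · intro P hP
      obtain ⟨i, -, rfl⟩ := (hmem P).1 hP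
      exact (mem_centralPrimitiveIdempotents_iff ψ').2 ⟨i, hr i, hψ' i⟩
    · intro P hP Q hQ h
      obtain ⟨i, -, rfl⟩ := (hmem P).1 hP
      obtain ⟨j, -, rfl⟩ := (hmem Q).1 hQ
      simp only [← hψ'] at h
      rw [blockIdempotent_injOn ψ' (hr i) (hr j) h]
    · intro Q hQ
      obtain ⟨i, -, rfl⟩ := (mem_centralPrimitiveIdempotents_iff ψ').1 hQ
      exact ⟨blockIdempotent ψ i, (hmem _).2 ⟨i, hd i, rfl⟩, (hψ' i).symm⟩
    · intro P hP
      obtain ⟨i, -, rfl⟩ := (hmem P).1 hP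
      rw [degree, degree, idempotentDegree_blockIdempotent ψ (hd i), ← hψ',
        idempotentDegree_blockIdempotent ψ' (hr i), ← hdr]
  · intro h
    have hdr : ∀ (X : C.fibers) i, d i = C.fibers.ncard * C.blockRank ψ X i := by
      rintro ⟨X, hX⟩ i
      obtain ⟨ψ', hψ'⟩ := C.exists_algEquiv_component ψ ⟨X, hX⟩
      obtain ⟨hbij, hdeg⟩ := h X hX
      have hP : blockIdempotent ψ i ∈ C.idempotents := (hmem _).2 ⟨i, hd i, rfl⟩
      -- `P_X` is nonzero, so the block rank of `X` is positive and equals the degree of `P_X`.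
      have hne : blockIdempotent ψ' i ≠ 0 := by
        rw [hψ']
        exact (hbij.mapsTo hP).2.1
      have := hdeg _ hP
      rwa [degree, degree, idempotentDegree_blockIdempotent ψ (hd i), ← hψ',
        idempotentDegree_blockIdempotent ψ' (size_pos_of_blockIdempotent_ne_zero ψ' hne)] at this
    rcases isEmpty_or_nonempty C.fibers with hemp | ⟨⟨X₀⟩⟩
    -- Without fibers, which happens only for empty `V`, every `r` does.
    · exact ⟨1, one_pos, fun X hX => (hemp.false ⟨X, hX⟩).elim⟩
    · have hpos : 0 < C.fibers.ncard := (Set.ncard_pos (Set.toFinite _)).2 ⟨X₀, X₀.2⟩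
      have heq : ∀ X i, C.blockRank ψ X i = C.blockRank ψ X₀ i := fun X i =>
        Nat.eq_of_mul_eq_mul_left hpos ((hdr X i).symm.trans (hdr X₀ i))
      refine ⟨(C.relBetween X₀ X₀).ncard, ?_, fun X hX Y hY => ?_⟩
      · obtain ⟨x, hx⟩ := X₀.2.1
        refine (Set.ncard_pos (Set.toFinite _)).2 ⟨_, mem_relBetween_of_mem X₀.2 X₀.2 X₀.2.2
          (p := (x, x)) ⟨hx, rfl⟩ hx hx⟩
      · rw [C.ncard_relBetween ψ ⟨X, hX⟩ ⟨Y, hY⟩, C.ncard_relBetween ψ X₀ X₀]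
        simp only [heq ⟨X, hX⟩, heq ⟨Y, hY⟩]
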